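/- Let $p$ be a prime, let $\overline{\mathbb{Q}}_p$ and $\overline{\mathbb{F}}_p$ be algebraic closures of $\mathbb{Q}_p$ and $\mathbb{F}_p$, and give $G_{\mathbb{Q}_p} = \mathrm{Gal}(\overline{\mathbb{Q}}_p/\mathbb{Q}_p)$ the Krull topology and $\overline{\mathbb{F}}_p$ the discrete topology. Let $\bar\rho : G_{\mathbb{Q}_p} \to \mathrm{GL}(V)$ be a continuous irreducible representation on an $\overline{\mathbb{F}}_p$-vector space $V$ of finite dimension $n$. Then $\overline{\mathbb{Q}}_p$ contains exactly one unramified extension $F$ of $\mathbb{Q}_p$ of degree $n$, and, writing $G_F = \mathrm{Gal}(\overline{\mathbb{Q}}_p/F)$, there is a continuous character $\chi : G_F \to \overline{\mathbb{F}}_p^{\times}$ such that $$\bar\rho \;\cong\; \mathrm{ind}_{G_F}^{G_{\mathbb{Q}_p}} \chi .$$ -/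

import Mathlib

namespace ModPGalois

/-- The absolute Galois group `Gal(ℚ̄_p / ℚ_p)`, with its Krull topology. -/
abbrev GQp (p : ℕ) [Fact p.Prime] : Type :=
  AlgebraicClosure ℚ_[p] ≃ₐ[ℚ_[p]] AlgebraicClosure ℚ_[p]

/-- `F / ℚ_p` is the (or an) unramified extension of degree `n` inside `ℚ̄_p`: it has degree `n`
and its ring of integers is unramified over `ℤ_p`. (For `n = 0` the degree condition would admit
infinite extensions; the definition is only used for `n ≥ 1`.) -/
def IsUnramifiedOfDegree (p : ℕ) [Fact p.Prime] (n : ℕ)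
    (F : IntermediateField ℚ_[p] (AlgebraicClosure ℚ_[p])) : Prop :=
  Module.finrank ℚ_[p] F = n ∧ Algebra.FormallyUnramified ℤ_[p] (integralClosure ℤ_[p] F)

/-- The one-dimensional representation on `k` attached to a character `χ : H → kˣ`. -/
noncomputable def characterRep {k H : Type*} [Field k] [Group H] (χ : H →* kˣ) :
    Representation k H k :=
  (Algebra.lmul k k).toMonoidHom.comp ((Units.coeHom k).comp χ)

/-- The representation `ind_H^G χ` induced from a character `χ` of a subgroup `H` of `G`. -/
noncomputable def indCharacter {k G : Type*} [Field k] [Group G] (H : Subgroup G)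
    (χ : H →* kˣ) : Representation k G (Representation.IndV H.subtype (characterRep χ)) :=
  Representation.ind H.subtype (characterRep χ)

end ModPGalois

/-! By continuity `ρ` factors through `Gal(L/ℚ_p)` for a finite normal `L`. Wild inertia `P` is a
normal `p`-group there, so in characteristic `p` it has nonzero fixed vectors; by irreducibility it
acts trivially (`apply_eq_one_of_isIrreducible_of_normal`). Inertia `I` then acts through commuting
operators, and has a common eigenvector of some weight `ψ`.

Modulo `P`, conjugation by a Frobenius `φ` raises `I` to the `p`-th power, so `φ⁻¹` carries weight
`ψ` to `ψ ^ p`. If `d` is the period of `ψ` under this map, `φ⁻ᵈ` preserves the `ψ`-space and has an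
eigenvector `w` in it. The vectors `φ⁻ⁱ w`, `i < d`, have distinct weights and a stable span, so
they form a basis and `d = n`. Thus the elements `φ ^ j σ` with `n ∣ j` and `σ ∈ I` preserve the
line of `w` (`exists_eigenvector_of_isIrreducible`).

These elements form `G_F` (`IsUnramifiedOfDegree.mem_fixingSubgroup_iff`). This description does not
depend on `F`, which also gives uniqueness. Finally Frobenius reciprocity maps `ind χ` onto `V`, and
dimensions agree because `[G : G_F] = n`. -/

namespace Module.End

/-- Pairwise commuting endomorphisms of a nonzero finite-dimensional space over an algebraically
closed field have a common eigenvector. -/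
theorem exists_common_eigenvector_of_commute {ι k V : Type*} [Field k] [IsAlgClosed k]
    [AddCommGroup V] [Module k V] [FiniteDimensional k V] [Nontrivial V] (f : ι → Module.End k V)
    (hf : ∀ i j, Commute (f i) (f j)) :
    ∃ w : V, w ≠ 0 ∧ ∀ i, ∃ c : k, f i w = c • w := by
  -- In a minimal nonzero stable subspace, each eigenspace of each `f i` is stable by commutation,
  -- so a nonzero one is everything: every `f i` is scalar on `W`.
  obtain ⟨W, ⟨hW0, hWf⟩, hmin⟩ := IsArtinian.set_has_minimal
    {W : Submodule k V | W ≠ ⊥ ∧ ∀ i, ∀ v ∈ W, f i v ∈ W}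
    ⟨⊤, top_ne_bot, fun _ _ _ => Submodule.mem_top⟩
  obtain ⟨w, hwW, hw0⟩ := W.ne_bot_iff.mp hW0
  refine ⟨w, hw0, fun i => ?_⟩
  have : Nontrivial W := Submodule.nontrivial_iff_ne_bot.mpr hW0
  obtain ⟨c, hc⟩ := Module.End.exists_eigenvalue ((f i).restrict (hWf i))
  obtain ⟨⟨u, huW⟩, hu⟩ := hc.exists_hasEigenvector
  have hu1 : f i u = c • u := congrArg Subtype.val hu.apply_eq_smul
  have hu0 : u ≠ 0 := fun h => hu.2 (Subtype.ext h)
  have hle : W ⊓ (f i).eigenspace c = W := by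
    refine eq_of_le_of_not_lt inf_le_left (hmin _ ⟨?_, ?_⟩)
    · exact (Submodule.ne_bot_iff _).mpr ⟨u, ⟨huW, mem_eigenspace_iff.mpr hu1⟩, hu0⟩
    · rintro j v ⟨hv, hv'⟩
      refine ⟨hWf j v hv, ?_⟩
      rw [SetLike.mem_coe, mem_eigenspace_iff] at hv'
      rw [SetLike.mem_coe, mem_eigenspace_iff, ← Module.End.mul_apply, (hf i j).eq,
        Module.End.mul_apply, hv', map_smul]
  exact ⟨c, mem_eigenspace_iff.mp (hle.ge hwW).2⟩

end Module.End

/-! ### Actions of `p`-groups in characteristic `p` -/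

namespace Representation

variable {k G V : Type*} [Field k] [Group G] [AddCommGroup V] [Module k V]

theorem eq_top_of_isIrreducible {ρ : Representation k G V} (hirr : ρ.IsIrreducible)
    (W : Submodule k V) (hW : W ≠ ⊥) (hstab : ∀ g, ∀ v ∈ W, ρ g v ∈ W) : W = ⊤ := by
  let W' : Subrepresentation ρ := ⟨W, fun g v hv => hstab g v hv⟩
  rcases hirr.eq_bot_or_eq_top W' with h | h
  · exact absurd (congrArg Subrepresentation.toSubmodule h) hW
  · exact congrArg Subrepresentation.toSubmodule h

theorem nontrivial_of_isIrreducible {ρ : Representation k G V} (hirr : ρ.IsIrreducible) :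
    Nontrivial V := by
  by_contra h
  rw [not_nontrivial_iff_subsingleton] at h
  obtain ⟨a, b, hab⟩ := hirr.toNontrivial
  exact hab (SetLike.ext fun x => by
    rw [Subsingleton.elim x 0]
    exact ⟨fun _ => b.toSubmodule.zero_mem, fun _ => a.toSubmodule.zero_mem⟩)

/-- A `p`-group acting additively on a vector space of characteristic `p`, through a finite
quotient, fixes a nonzero vector. -/
theorem exists_ne_zero_forall_apply_eq_of_isPGroup (p : ℕ) [Fact p.Prime] {M Q : Type*}
    [AddCommGroup M] [Module (ZMod p) M] [Nontrivial M] [Group Q] [Finite Q]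
    [DistribMulAction Q M] (hQ : IsPGroup p Q) : ∃ w : M, w ≠ 0 ∧ ∀ g : Q, g • w = w := by
  obtain ⟨v, hv⟩ := exists_ne (0 : M)
  let A : Submodule (ZMod p) M := Submodule.span (ZMod p) (Set.range fun g : Q => g • v)
  have hA : Finite A := by
    have : Module.Finite (ZMod p) A := Module.Finite.span_of_finite _ (Set.finite_range _)
    exact Module.finite_of_finite (ZMod p)
  have hstab : ∀ g : Q, ∀ x ∈ A, g • x ∈ A := by
    intro g x hx
    induction hx using Submodule.span_induction with
    | mem x h =>
      obtain ⟨g', rfl⟩ := h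
      exact Submodule.subset_span ⟨g * g', mul_smul _ _ _⟩
    | zero => rw [smul_zero]; exact A.zero_mem
    | add x y _ _ hx hy => rw [smul_add]; exact add_mem hx hy
    | smul a x _ hx =>
      have : g • (a • x) = a • (g • x) := ZMod.map_smul (DistribSMul.toAddMonoidHom M g) a x
      rw [this]
      exact A.smul_mem a hx
  let act : MulAction Q A :=
    { smul := fun q x => ⟨q • (x : M), hstab q x x.2⟩
      one_smul := fun x => Subtype.ext (one_smul Q (x : M))
      mul_smul := fun a b x => Subtype.ext (mul_smul a b (x : M)) }
  have hv' : v ∈ A := Submodule.subset_span ⟨1, one_smul _ _⟩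
  have hA' : Nontrivial A := ⟨⟨⟨v, hv'⟩, 0, fun h => hv (congrArg Subtype.val h)⟩⟩
  -- Orbit counting: the number of fixed points of a `p`-group on the finite set `A` is divisible by
  -- `p`, so `0` is not the only one.
  have hcard : p ∣ Nat.card A := by
    rw [Module.natCard_eq_pow_finrank (K := ZMod p), Nat.card_zmod]
    exact dvd_pow_self _ (Module.finrank_pos (R := ZMod p) (M := A)).ne'
  obtain ⟨b, hb, hb0⟩ := hQ.exists_fixed_point_of_prime_dvd_card_of_fixed_point A hcard
    (a := 0) (fun q => Subtype.ext (smul_zero q))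
  exact ⟨b, fun h => hb0 (Subtype.ext h.symm), fun g => congrArg Subtype.val (hb g)⟩

/-- A group acting through a finite `p`-group on a nonzero vector space of characteristic `p`
fixes a nonzero vector. -/
theorem exists_ne_zero_forall_apply_eq_of_pow_prime_pow_eq_one (p : ℕ) [Fact p.Prime] [CharP k p]
    [Nontrivial V] (ρ : Representation k G V) (hfin : (Set.range ρ).Finite)
    (hp : ∀ g, ∃ m : ℕ, ρ g ^ p ^ m = 1) : ∃ w : V, w ≠ 0 ∧ ∀ g, ρ g w = w := by
  let Q := MonoidHom.range (MonoidHom.toHomUnits ρ)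
  have hQ : IsPGroup p Q := by
    rintro ⟨_, g, rfl⟩
    obtain ⟨m, hm⟩ := hp g
    exact ⟨m, Subtype.ext (Units.ext (by simpa using hm))⟩
  have hQf : Finite Q := by
    have : Finite (Set.range ρ) := hfin
    refine Finite.of_injective (β := Set.range ρ)
      (fun q => ⟨(q.1 : V →ₗ[k] V), by obtain ⟨_, g, rfl⟩ := q; exact ⟨g, rfl⟩⟩) ?_
    intro a b h
    exact Subtype.ext (Units.ext (congrArg Subtype.val h))
  let : Module (ZMod p) V := AddCommGroup.zmodModule (n := p) fun x => by
    rw [← Nat.cast_smul_eq_nsmul k, CharP.cast_eq_zero, zero_smul]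
  let act : DistribMulAction Q V :=
    { smul := fun q x => (q.1 : V →ₗ[k] V) x
      one_smul := fun x => rfl
      mul_smul := fun a b x => rfl
      smul_zero := fun a => map_zero (a.1 : V →ₗ[k] V)
      smul_add := fun a => map_add (a.1 : V →ₗ[k] V) }
  obtain ⟨w, hw0, hw⟩ := exists_ne_zero_forall_apply_eq_of_isPGroup (M := V) p hQ
  exact ⟨w, hw0, fun g => hw ⟨MonoidHom.toHomUnits ρ g, g, rfl⟩⟩

/-- If `P` is a normal subgroup acting through a finite `p`-group, then it acts trivially on every
irreducible representation of characteristic `p`. -/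
theorem apply_eq_one_of_isIrreducible_of_normal (p : ℕ) [Fact p.Prime] [CharP k p]
    {ρ : Representation k G V} (hirr : ρ.IsIrreducible) (hfin : (Set.range ρ).Finite)
    (P : Subgroup G) [hPn : P.Normal] (hp : ∀ g ∈ P, ∃ m : ℕ, ρ g ^ p ^ m = 1)
    {g : G} (hg : g ∈ P) : ρ g = 1 := by
  have := nontrivial_of_isIrreducible hirr
  -- The `P`-invariants: nonzero by the fixed-vector lemma, and `G`-stable because `P` is normal.
  let W : Submodule k V := ⨅ g : P, LinearMap.ker (ρ g - 1)
  have hmem : ∀ w, w ∈ W ↔ ∀ g ∈ P, ρ g w = w := by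
    intro w
    simp [W, Submodule.mem_iInf, sub_eq_zero]
  obtain ⟨w, hw0, hw⟩ := exists_ne_zero_forall_apply_eq_of_pow_prime_pow_eq_one p
    (MonoidHom.comp ρ P.subtype : Representation k P V)
    (hfin.subset (by rintro _ ⟨g, rfl⟩; exact ⟨g, rfl⟩)) (fun g => hp g g.2)
  have htop : W = ⊤ := by
    refine eq_top_of_isIrreducible hirr W
      (W.ne_bot_iff.mpr ⟨w, (hmem w).mpr fun g hg => hw ⟨g, hg⟩, hw0⟩) ?_
    intro g v hv
    rw [hmem] at hv ⊢
    intro h hh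
    have h1 := hv _ (hPn.conj_mem h hh g⁻¹)
    rw [inv_inv] at h1
    calc ρ h (ρ g v) = ρ g (ρ (g⁻¹ * h * g) v) := by
          rw [← Module.End.mul_apply, ← Module.End.mul_apply, ← map_mul, ← map_mul]
          congr 2
          group
      _ = ρ g v := by rw [h1]
  ext v
  exact (hmem v).mp (htop ▸ Submodule.mem_top) g hg

end Representation

/-! ### Weights of inertia and their permutation by Frobenius -/

namespace Representation

variable {k G V : Type*} [Field k] [Group G] [AddCommGroup V] [Module k V]

/-- The simultaneous eigenspace of the operators `ρ σ`, `σ ∈ I`, with eigenvalues `ψ σ`. -/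
def weightSpace (ρ : Representation k G V) (I : Subgroup G) (ψ : I → k) : Submodule k V :=
  ⨅ σ : I, Module.End.eigenspace (ρ σ) (ψ σ)

theorem mem_weightSpace {ρ : Representation k G V} {I : Subgroup G} {ψ : I → k} {v : V} :
    v ∈ ρ.weightSpace I ψ ↔ ∀ σ : I, ρ σ v = ψ σ • v := by
  simp [weightSpace, Submodule.mem_iInf]

/-- Simultaneous generalized eigenspaces of commuting operators are independent, and weight spaces
lie inside them. -/
theorem linearIndependent_of_mem_weightSpace {ι : Type*} (ρ : Representation k G V)
    (I : Subgroup G) (hcomm : ∀ σ ∈ I, ∀ τ ∈ I, Commute (ρ σ) (ρ τ)) (ψ : ι → I → k)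
    (hψ : Function.Injective ψ) (v : ι → V) (hv : ∀ i, v i ∈ ρ.weightSpace I (ψ i))
    (hv0 : ∀ i, v i ≠ 0) : LinearIndependent k v := by
  have h := Module.End.independent_iInf_maxGenEigenspace_of_forall_mapsTo (fun σ : I => ρ σ)
    (fun σ τ c => Module.End.mapsTo_maxGenEigenspace_of_comm (hcomm _ τ.2 _ σ.2) c)
  refine (h.comp hψ).linearIndependent _ (fun i => ?_) hv0
  refine (Submodule.mem_iInf _).mpr fun σ => ?_
  exact Module.End.genEigenspace_le_maximal (ρ σ) (ψ i σ) 1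
    (Module.End.mem_eigenspace_iff.mpr (mem_weightSpace.mp (hv i) σ))

/-- Let `P ≤ I` be normal subgroups of `G` such that `P` acts through a `p`-group, `I / P` is
abelian, `φ` acts on `I / P` as the `p`-th power map and `G` is generated by `I` and the powers of
`φ`. Then every irreducible representation of `G` of dimension `n` and characteristic `p`, with
finite image, contains a line stable under all `φ ^ j σ`, with `n ∣ j` and `σ ∈ I`. -/
theorem exists_eigenvector_of_isIrreducible (p : ℕ) [Fact p.Prime] [CharP k p] [IsAlgClosed k]
    [FiniteDimensional k V] {ρ : Representation k G V} (hirr : ρ.IsIrreducible)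
    (hfin : (Set.range ρ).Finite) (P I : Subgroup G) [hPn : P.Normal]
    (hp : ∀ g ∈ P, ∃ m : ℕ, ρ g ^ p ^ m = 1)
    (hcomm : ∀ σ ∈ I, ∀ τ ∈ I, σ * τ * (τ * σ)⁻¹ ∈ P) (φ : G)
    (hφ : ∀ σ ∈ I, φ * σ * φ⁻¹ * (σ ^ p)⁻¹ ∈ P)
    (hgen : ∀ g, ∃ j : ℕ, ∃ σ ∈ I, g = φ ^ j * σ) :
    ∃ w : V, w ≠ 0 ∧ ∀ j : ℕ, Module.finrank k V ∣ j → ∀ σ ∈ I, ∃ c : k, ρ (φ ^ j * σ) w = c • w := by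
  have := nontrivial_of_isIrreducible hirr
  have hcongr : ∀ a b : G, a * b⁻¹ ∈ P → ρ a = ρ b := by
    intro a b h
    have h1 := apply_eq_one_of_isIrreducible_of_normal p hirr hfin P hp h
    rw [← inv_mul_cancel_right a b, map_mul, h1, one_mul]
  have hcomm' : ∀ σ ∈ I, ∀ τ ∈ I, Commute (ρ σ) (ρ τ) := by
    intro σ hσ τ hτ
    rw [Commute, SemiconjBy, ← map_mul, ← map_mul]
    exact hcongr _ _ (hcomm σ hσ τ hτ)
  obtain ⟨u, hu0, hu⟩ := Module.End.exists_common_eigenvector_of_commute (fun σ : I => ρ σ)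
    (fun σ τ => hcomm' σ σ.2 τ τ.2)
  choose ψ hψ using hu
  -- The effect of `φ⁻¹` on weights. Using `φ⁻¹` rather than `φ` avoids extracting `p`-th roots.
  let T : (I → k) → I → k := fun c σ => c σ ^ p
  have hTinj : ∀ (v : V) (c c' : I → k), v ≠ 0 → v ∈ ρ.weightSpace I c →
      v ∈ ρ.weightSpace I c' → c = c' := by
    intro v c c' hv h h'
    funext σ
    exact smul_left_injective k hv
      ((mem_weightSpace.mp h σ).symm.trans (mem_weightSpace.mp h' σ))
  have hA : ∀ c v, v ∈ ρ.weightSpace I c → ρ φ⁻¹ v ∈ ρ.weightSpace I (T c) := by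
    intro c v hv
    rw [mem_weightSpace] at hv ⊢
    intro σ
    have hpow : ∀ m : ℕ, (ρ σ ^ m) v = c σ ^ m • v := by
      intro m
      induction m with
      | zero => simp
      | succ m ih => rw [pow_succ, Module.End.mul_apply, hv, map_smul, ih, smul_smul, pow_succ']
    calc ρ σ (ρ φ⁻¹ v) = ρ φ⁻¹ (ρ (φ * σ * φ⁻¹) v) := by
          rw [← Module.End.mul_apply, ← Module.End.mul_apply, ← map_mul, ← map_mul]
          congr 2
          group
      _ = ρ φ⁻¹ ((ρ σ ^ p) v) := by rw [hcongr _ _ (hφ σ σ.2), map_pow]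
      _ = T c σ • ρ φ⁻¹ v := by rw [hpow, map_smul]
  have hAi : ∀ (i : ℕ) c v, v ∈ ρ.weightSpace I c →
      (ρ φ⁻¹ ^ i) v ∈ ρ.weightSpace I (T^[i] c) := by
    intro i
    induction i with
    | zero => intro c v hv; simpa using hv
    | succ i ih =>
      intro c v hv
      rw [pow_succ, Module.End.mul_apply, Function.iterate_succ_apply]
      exact ih _ _ (hA c v hv)
  obtain ⟨m, hm0, hm⟩ : ∃ m : ℕ, 0 < m ∧ ρ φ⁻¹ ^ m = 1 := by
    have hf : Finite (Set.range ρ) := hfin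
    obtain ⟨a, b, hab, h⟩ := Finite.exists_ne_map_eq_of_infinite
      (fun i : ℕ => (⟨ρ (φ⁻¹ ^ i), φ⁻¹ ^ i, rfl⟩ : Set.range ρ))
    have h' : ρ (φ⁻¹ ^ a) = ρ (φ⁻¹ ^ b) := congrArg Subtype.val h
    have key : ∀ a b : ℕ, a < b → ρ (φ⁻¹ ^ a) = ρ (φ⁻¹ ^ b) →
        ∃ m : ℕ, 0 < m ∧ ρ φ⁻¹ ^ m = 1 := by
      intro a b hab h
      refine ⟨b - a, by omega, ?_⟩
      have h2 : ρ ((φ⁻¹ ^ a)⁻¹) * ρ (φ⁻¹ ^ a) = ρ ((φ⁻¹ ^ a)⁻¹) * ρ (φ⁻¹ ^ b) := by rw [h]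
      rw [← map_mul, ← map_mul, inv_mul_cancel, map_one] at h2
      rw [← map_pow, h2]
      congr 1
      rw [eq_inv_mul_iff_mul_eq, ← pow_add]
      congr 1
      omega
    rcases lt_or_gt_of_ne hab with hl | hl
    · exact key a b hl h'
    · exact key b a hl h'.symm
  have hinj : Function.Injective (ρ φ⁻¹) := by
    refine Function.LeftInverse.injective (g := ρ φ) fun x => ?_
    rw [← Module.End.mul_apply, ← map_mul, mul_inv_cancel, map_one, Module.End.one_apply]
  have hinji : ∀ i : ℕ, Function.Injective (ρ φ⁻¹ ^ i : Module.End k V) := by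
    intro i
    rw [Module.End.coe_pow]
    exact hinj.iterate i
  have huψ : u ∈ ρ.weightSpace I ψ := mem_weightSpace.mpr hψ
  -- `φ⁻ᵐ` acts trivially, so the nonzero vector `u` has both weights `ψ` and `T^[m] ψ`.
  have hper : Function.IsPeriodicPt T m ψ := by
    have h := hAi m ψ u huψ
    rw [hm, Module.End.one_apply] at h
    exact (hTinj u _ _ hu0 huψ h).symm
  set d := Function.minimalPeriod T ψ with hd
  have hd0 : 0 < d := hper.minimalPeriod_pos hm0
  have hTd : T^[d] ψ = ψ := Function.isPeriodicPt_minimalPeriod T ψ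
  let W := ρ.weightSpace I ψ
  have hWstab : ∀ v ∈ W, (ρ φ⁻¹ ^ d) v ∈ W := by
    intro v hv
    have h := hAi d ψ v hv
    rwa [hTd] at h
  have : Nontrivial W := Submodule.nontrivial_iff_ne_bot.mpr (W.ne_bot_iff.mpr ⟨u, huψ, hu0⟩)
  obtain ⟨c, hc⟩ := Module.End.exists_eigenvalue ((ρ φ⁻¹ ^ d).restrict hWstab)
  obtain ⟨⟨w, hwW⟩, hw⟩ := hc.exists_hasEigenvector
  have hwc : (ρ φ⁻¹ ^ d) w = c • w := congrArg Subtype.val hw.apply_eq_smul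
  have hw0 : w ≠ 0 := fun h => hw.2 (Subtype.ext h)
  have hc0 : c ≠ 0 := by
    rintro rfl
    rw [zero_smul] at hwc
    exact hw0 (hinji d (hwc.trans (map_zero _).symm))
  have hwi : ∀ i : ℕ, (ρ φ⁻¹ ^ i) w ∈ ρ.weightSpace I (T^[i] ψ) := fun i => hAi i ψ w hwW
  have hred : ∀ q r : ℕ, (ρ φ⁻¹ ^ (d * q + r)) w = c ^ q • (ρ φ⁻¹ ^ r) w := by
    intro q r
    induction q with
    | zero => simp
    | succ q ih =>
      rw [show d * (q + 1) + r = (d * q + r) + d by ring, pow_add, Module.End.mul_apply, hwc,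
        map_smul, ih, smul_smul, pow_succ']
  let b : Fin d → V := fun i => (ρ φ⁻¹ ^ (i : ℕ)) w
  have hb : LinearIndependent k b := by
    refine linearIndependent_of_mem_weightSpace ρ I hcomm' (fun i : Fin d => T^[i] ψ) ?_ b
      (fun i => hwi i) (fun i h => hw0 (hinji i (h.trans (map_zero _).symm)))
    intro i j hij
    exact Fin.ext (Function.iterate_injOn_Iio_minimalPeriod i.2 j.2 hij)
  have hmem : ∀ i : ℕ, (ρ φ⁻¹ ^ i) w ∈ Submodule.span k (Set.range b) := by
    intro i
    rw [← Nat.div_add_mod i d, hred]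
    exact Submodule.smul_mem _ _ (Submodule.subset_span ⟨⟨i % d, Nat.mod_lt _ hd0⟩, rfl⟩)
  -- Expresses `φ` through nonnegative powers of `φ⁻¹`, under which the span of `b` is visibly
  -- stable.
  have hφA : ρ φ = ρ φ⁻¹ ^ (m - 1) := by
    calc ρ φ = ρ φ * (ρ φ⁻¹ * ρ φ⁻¹ ^ (m - 1)) := by
          rw [← pow_succ', Nat.sub_add_cancel hm0, hm, mul_one]
      _ = ρ φ⁻¹ ^ (m - 1) := by
          rw [← mul_assoc, ← map_mul, mul_inv_cancel, map_one, one_mul]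
  have htop : Submodule.span k (Set.range b) = ⊤ := by
    refine eq_top_of_isIrreducible hirr _ ?_ ?_
    · refine (Submodule.ne_bot_iff _).mpr ⟨w, ?_, hw0⟩
      simpa using hmem 0
    · intro g
      obtain ⟨j, σ, hσ, rfl⟩ := hgen g
      change Submodule.span k (Set.range b) ≤
        (Submodule.span k (Set.range b)).comap (ρ (φ ^ j * σ))
      rw [Submodule.span_le]
      rintro _ ⟨i, rfl⟩
      rw [SetLike.mem_coe, Submodule.mem_comap, map_mul, Module.End.mul_apply,
        mem_weightSpace.mp (hwi i) ⟨σ, hσ⟩, map_smul, map_pow, hφA, ← pow_mul,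
        ← Module.End.mul_apply, ← pow_add]
      exact Submodule.smul_mem _ _ (hmem _)
  have hfr : Module.finrank k V = d := by
    rw [Module.finrank_eq_card_basis (Module.Basis.mk hb htop.ge), Fintype.card_fin]
  refine ⟨w, hw0, ?_⟩
  rintro j ⟨q, rfl⟩ σ hσ
  rw [hfr]
  have hq : ρ (φ ^ (d * q)) w = (c ^ q)⁻¹ • w := by
    have h := hred q 0
    rw [add_zero, pow_zero, Module.End.one_apply] at h
    rw [eq_inv_smul_iff₀ (pow_ne_zero q hc0), ← map_smul, ← h, ← map_pow, ← Module.End.mul_apply,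
      ← map_mul, inv_pow, mul_inv_cancel, map_one, Module.End.one_apply]
  refine ⟨ψ ⟨σ, hσ⟩ * (c ^ q)⁻¹, ?_⟩
  rw [map_mul, Module.End.mul_apply, mem_weightSpace.mp hwW ⟨σ, hσ⟩, map_smul, hq, smul_smul]

/-! ### Stable lines and induced representations -/

/-- A character of `H` through which `H` acts on a stable line. -/
theorem exists_character_of_forall_exists_smul (ρ : Representation k G V) (H : Subgroup G)
    (w : V) (hw0 : w ≠ 0) (hw : ∀ h ∈ H, ∃ c : k, ρ h w = c • w) :
    ∃ χ : H →* kˣ, ∀ h : H, ρ h w = (χ h : k) • w := by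
  choose c hc using fun h : H => hw h h.2
  have hcinj := smul_left_injective k hw0
  let f : H →* k :=
    { toFun := c
      map_one' := hcinj (by
        show c 1 • w = (1 : k) • w
        rw [← hc, Subgroup.coe_one, map_one, one_smul, Module.End.one_apply])
      map_mul' := fun a b => hcinj (by
        show c (a * b) • w = (c a * c b) • w
        rw [← hc, Subgroup.coe_mul, map_mul, Module.End.mul_apply, hc b, map_smul, hc a, smul_smul,
          mul_comm]) }
  exact ⟨f.toHomUnits, hc⟩

open ModPGalois in
/-- Frobenius reciprocity: the map `ind_H^G χ → V` attached to an eigenvector of `H` of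
character `χ`. -/
theorem exists_linearMap_indCharacter (ρ : Representation k G V) (H : Subgroup G) (χ : H →* kˣ)
    (w : V) (hw : ∀ h : H, ρ h w = (χ h : k) • w) :
    ∃ F : IndV H.subtype (characterRep χ) →ₗ[k] V,
      ∀ g a, F (IndV.mk H.subtype (characterRep χ) g a) = a • ρ g⁻¹ w := by
  refine ⟨Representation.Coinvariants.lift _
    (TensorProduct.lift <| (Finsupp.lift _ _ _ fun g => ρ g⁻¹ ∘ₗ LinearMap.toSpanSingleton k V w) ∘ₗ
      (MonoidAlgebra.coeffLinearEquiv k).toLinearMap) fun h => ?_, fun g a => ?_⟩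
  -- The map `g ⊗ a ↦ a • ρ g⁻¹ w` descends to coinvariants: replacing `g` by `h * g` contributes
  -- `(χ h)⁻¹`, which cancels the action of `h` on `a`.
  · have hinv : ρ (h : G)⁻¹ w = ((χ h)⁻¹ : k) • w := by
      have := hw h⁻¹
      rwa [map_inv χ, Units.val_inv_eq_inv_val] at this
    ext g
    simp [ofMulAction_single, mul_inv_rev, characterRep, hinv, smul_smul]
  · simp

open ModPGalois in
-- In the coinvariants the generators at `h * g` and `g` are proportional, so one generator per
-- coset suffices. The upper bound is enough, since a surjection onto `V` supplies the other
-- inequality.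
theorem finrank_indV_characterRep_le (H : Subgroup G) [H.FiniteIndex] (χ : H →* kˣ) :
    Module.Finite k (IndV H.subtype (characterRep χ)) ∧
      Module.finrank k (IndV H.subtype (characterRep χ)) ≤ H.index := by
  let mk : G → IndV H.subtype (characterRep χ) := fun g =>
    IndV.mk H.subtype (characterRep χ) g 1
  have hmkH : ∀ (h : H) (g : G), (χ h : k) • mk (h * g) = mk g := by
    intro h g
    have := Coinvariants.mk_self_apply
      (Representation.tprod ((leftRegular k G).comp H.subtype) (characterRep χ)) h
      (TensorProduct.tmul k (MonoidAlgebra.single g 1) 1)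
    have e : (Representation.tprod ((leftRegular k G).comp H.subtype) (characterRep χ)) h
        (TensorProduct.tmul k (MonoidAlgebra.single g 1) 1) =
        (χ h : k) • TensorProduct.tmul k (MonoidAlgebra.single (h * g : G) 1) (1 : k) := by
      rw [← TensorProduct.tmul_smul]
      simp [ofMulAction_single, characterRep]
    rw [e, map_smul] at this
    exact this
  let : Fintype (G ⧸ H) := Fintype.ofFinite _
  let b : G ⧸ H → IndV H.subtype (characterRep χ) := fun q => mk q.out⁻¹
  have hspan : Submodule.span k (Set.range b) = ⊤ := by
    have hmk : ∀ g, mk g ∈ Submodule.span k (Set.range b) := by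
      intro g
      obtain ⟨h, hh⟩ := QuotientGroup.mk_out_eq_mul H g⁻¹
      have hb : mk (h⁻¹ * g : G) ∈ Submodule.span k (Set.range b) :=
        Submodule.subset_span ⟨(g⁻¹ : G), by simp only [b]; rw [hh]; simp⟩
      have := hmkH h⁻¹ g
      rw [← this]
      exact Submodule.smul_mem _ _ hb
    have h0 : (Submodule.span k (Set.range b)).mkQ = 0 := by
      refine IndV.hom_ext _ _ fun g => LinearMap.ext_ring ?_
      exact (Submodule.Quotient.mk_eq_zero _).mpr (hmk g)
    rw [← Submodule.ker_mkQ (Submodule.span k (Set.range b)), h0, LinearMap.ker_zero]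
  refine ⟨.of_fg_top (hspan ▸ Submodule.fg_span (Set.finite_range b)), ?_⟩
  rw [← finrank_top, ← hspan, H.index_eq_card, Nat.card_eq_fintype_card]
  exact finrank_range_le_card b

open ModPGalois in
/-- An irreducible representation of dimension `[G : H]` with an `H`-stable line of character `χ`
is induced from `χ`. -/
theorem nonempty_equiv_indCharacter [FiniteDimensional k V] {ρ : Representation k G V}
    (hirr : ρ.IsIrreducible) (H : Subgroup G) (hH : H.index = Module.finrank k V) (χ : H →* kˣ)
    (w : V) (hw0 : w ≠ 0) (hw : ∀ h : H, ρ h w = (χ h : k) • w) :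
    Nonempty (ρ.Equiv (indCharacter H χ)) := by
  have := nontrivial_of_isIrreducible hirr
  have : H.FiniteIndex := ⟨by rw [hH]; exact Module.finrank_pos.ne'⟩
  obtain ⟨F, hF⟩ := exists_linearMap_indCharacter ρ H χ w hw
  obtain ⟨hfin, hle⟩ := finrank_indV_characterRep_le (k := k) H χ
  have hFG : ∀ g, F ∘ₗ indCharacter H χ g = ρ g ∘ₗ F := by
    intro g
    refine IndV.hom_ext _ _ fun g' => LinearMap.ext fun a => ?_
    change F (ind H.subtype (characterRep χ) g (IndV.mk H.subtype (characterRep χ) g' a)) =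
      ρ g (F (IndV.mk H.subtype (characterRep χ) g' a))
    rw [ind_mk, hF, hF, map_smul, ← Module.End.mul_apply, ← map_mul, mul_inv_rev, inv_inv]
  have hsurj : Function.Surjective F := by
    rw [← LinearMap.range_eq_top]
    refine eq_top_of_isIrreducible hirr _ ?_ ?_
    · refine (Submodule.ne_bot_iff _).mpr ⟨w, ⟨IndV.mk H.subtype (characterRep χ) 1 1, ?_⟩, hw0⟩
      rw [hF, one_smul, inv_one, map_one, Module.End.one_apply]
    · rintro g _ ⟨x, rfl⟩
      exact ⟨indCharacter H χ g x, LinearMap.congr_fun (hFG g) x⟩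
  have hfr : Module.finrank k (IndV H.subtype (characterRep χ)) = Module.finrank k V :=
    le_antisymm (hle.trans hH.le) (LinearMap.finrank_le_finrank_of_surjective hsurj)
  have hinj : Function.Injective F :=
    (LinearMap.injective_iff_surjective_of_finrank_eq_finrank hfr).mpr hsurj
  exact ⟨(Equiv.mk (LinearEquiv.ofBijective F ⟨hinj, hsurj⟩) hFG).symm⟩

end Representation

/-! ### Inertia and wild inertia through the norm -/

namespace ModPGalois

section Ultrametric

variable {K : Type*} [NormedField K] [IsUltrametricDist K]

theorem norm_sub_lt_of_lt {x y z : K} {r : ℝ} (h₁ : ‖x - y‖ < r) (h₂ : ‖y - z‖ < r) :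
    ‖x - z‖ < r := by
  rw [← sub_add_sub_cancel x y z]
  exact (IsUltrametricDist.norm_add_le_max _ _).trans_lt (max_lt h₁ h₂)

theorem norm_mul_sub_mul_lt_one {x x' y y' : K} (hx : ‖x‖ ≤ 1) (hy : ‖y'‖ ≤ 1)
    (h₁ : ‖x - x'‖ < 1) (h₂ : ‖y - y'‖ < 1) : ‖x * y - x' * y'‖ < 1 := by
  refine norm_sub_lt_of_lt (y := x * y') ?_ ?_
  · rw [← mul_sub, norm_mul]
    exact mul_lt_one_of_nonneg_of_lt_one_right hx (norm_nonneg _) h₂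
  · rw [← sub_mul, norm_mul]
    exact mul_lt_one_of_nonneg_of_lt_one_left (norm_nonneg _) h₁ hy

theorem norm_pow_sub_pow_lt_one {x y : K} (hx : ‖x‖ ≤ 1) (hy : ‖y‖ ≤ 1) (h : ‖x - y‖ < 1)
    (m : ℕ) : ‖x ^ m - y ^ m‖ < 1 := by
  induction m with
  | zero => simp
  | succ m ih =>
    rw [pow_succ, pow_succ]
    exact norm_mul_sub_mul_lt_one (by rw [norm_pow]; exact pow_le_one₀ (norm_nonneg _) hx) hy ih h

end Ultrametric

variable {p : ℕ} [Fact p.Prime]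

theorem norm_galois_apply (g : GQp p) (x : AlgebraicClosure ℚ_[p]) : ‖g x‖ = ‖x‖ :=
  (spectralNorm_eq_of_equiv g x).symm

theorem apply_mem_of_normal (L : IntermediateField ℚ_[p] (AlgebraicClosure ℚ_[p]))
    [Normal ℚ_[p] L] (g : GQp p) {x : AlgebraicClosure ℚ_[p]} (hx : x ∈ L) : g x ∈ L := by
  have := AlgEquiv.restrictNormal_commutes g L ⟨x, hx⟩
  rw [show g x = _ from this.symm]
  exact (g.restrictNormal L ⟨x, hx⟩).2

/-- The preimage in the absolute Galois group of the inertia group of `L / ℚ_p`. -/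
def inertia (L : IntermediateField ℚ_[p] (AlgebraicClosure ℚ_[p])) [Normal ℚ_[p] L] :
    Subgroup (GQp p) where
  carrier := {g | ∀ x ∈ L, ‖x‖ ≤ 1 → ‖g x - x‖ < 1}
  one_mem' := fun x _ _ => by simp
  mul_mem' := fun {g h} hg hh x hx hx1 => by
    refine norm_sub_lt_of_lt (y := g x) ?_ (hg x hx hx1)
    rw [AlgEquiv.mul_apply, ← map_sub, norm_galois_apply]
    exact hh x hx hx1
  inv_mem' := fun {g} hg x hx hx1 => by
    rw [← norm_galois_apply g, map_sub, norm_sub_rev, ← AlgEquiv.mul_apply, mul_inv_cancel]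
    exact hg x hx hx1

/-- The preimage in the absolute Galois group of the wild inertia group of `L / ℚ_p`. -/
def wildInertia (L : IntermediateField ℚ_[p] (AlgebraicClosure ℚ_[p])) [Normal ℚ_[p] L] :
    Subgroup (GQp p) where
  carrier := {g | ∀ x ∈ L, x ≠ 0 → ‖g x - x‖ < ‖x‖}
  one_mem' := fun x _ hx => by simpa using hx
  mul_mem' := fun {g h} hg hh x hx hx0 => by
    refine norm_sub_lt_of_lt (y := g x) ?_ (hg x hx hx0)
    rw [AlgEquiv.mul_apply, ← map_sub, norm_galois_apply]
    exact hh x hx hx0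
  inv_mem' := fun {g} hg x hx hx0 => by
    rw [← norm_galois_apply g, map_sub, norm_sub_rev, ← AlgEquiv.mul_apply, mul_inv_cancel]
    exact hg x hx hx0

variable (L : IntermediateField ℚ_[p] (AlgebraicClosure ℚ_[p])) [Normal ℚ_[p] L]

instance wildInertia_normal : (wildInertia L).Normal where
  conj_mem := fun n hn g x hx hx0 => by
    have h := hn (g⁻¹ x) (apply_mem_of_normal L g⁻¹ hx) (by simpa using hx0)
    have e : (g * n * g⁻¹) x - x = g (n (g⁻¹ x) - g⁻¹ x) := by
      rw [map_sub, ← AlgEquiv.mul_apply g g⁻¹ x, mul_inv_cancel]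
      rfl
    rwa [e, norm_galois_apply, ← norm_galois_apply g⁻¹ x]

theorem norm_apply_div_self (σ : GQp p) {y : AlgebraicClosure ℚ_[p]} (hy : y ≠ 0) :
    ‖σ y / y‖ = 1 := by
  rw [norm_div, norm_galois_apply, div_self (norm_ne_zero_iff.mpr hy)]

/-- If `σ ∈ I` and `y ≠ 0`, then `σ ^ m y / y` agrees with `(σ y / y) ^ m` in the residue field. -/
theorem norm_pow_apply_div_sub_lt_one {σ : GQp p} (hσ : σ ∈ inertia L)
    {y : AlgebraicClosure ℚ_[p]} (hyL : y ∈ L) (hy : y ≠ 0) (m : ℕ) :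
    ‖(σ ^ m) y / y - (σ y / y) ^ m‖ < 1 := by
  have h1 := norm_apply_div_self σ hy
  have haL : σ y / y ∈ L := L.div_mem (apply_mem_of_normal L σ hyL) hyL
  have hσy : σ y ≠ 0 := by simpa using hy
  induction m with
  | zero => simp [hy]
  | succ m ih =>
    -- A cocycle identity; inertia fixes residues of units, so modulo the maximal ideal the cocycle
    -- is multiplicative. No uniformizer is needed.
    have e : (σ ^ (m + 1)) y / y = σ ((σ ^ m) y / y) * (σ y / y) := by
      rw [pow_succ', AlgEquiv.mul_apply, map_div₀]
      field_simp
    rw [e, pow_succ]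
    refine norm_mul_sub_mul_lt_one ?_ h1.le ?_ (by simp)
    · rw [norm_galois_apply]
      exact (norm_apply_div_self _ hy).le
    · refine norm_sub_lt_of_lt (y := σ ((σ y / y) ^ m)) ?_ ?_
      · rwa [← map_sub, norm_galois_apply]
      · exact hσ _ (pow_mem haL m) (by rw [norm_pow, h1, one_pow])

/-- Tame inertia is abelian. -/
theorem commutator_mem_wildInertia {σ τ : GQp p} (hσ : σ ∈ inertia L) (hτ : τ ∈ inertia L) :
    σ * τ * (τ * σ)⁻¹ ∈ wildInertia L := by
  have key : ∀ y ∈ L, y ≠ 0 → ‖(σ * τ) y / y - (τ * σ) y / y‖ < 1 := by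
    intro y hyL hy
    have hσy : σ y ≠ 0 := by simpa using hy
    have hτy : τ y ≠ 0 := by simpa using hy
    have hb := norm_apply_div_self τ hy
    have ha := norm_apply_div_self σ hy
    have e1 : (σ * τ) y / y = σ (τ y / y) * (σ y / y) := by
      rw [AlgEquiv.mul_apply, map_div₀]; field_simp
    have e2 : (τ * σ) y / y = τ (σ y / y) * (τ y / y) := by
      rw [AlgEquiv.mul_apply, map_div₀]; field_simp
    rw [e1, e2, mul_comm (τ _)]
    refine norm_mul_sub_mul_lt_one ?_ ?_ ?_ ?_
    · rw [norm_galois_apply, hb]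
    · rw [norm_galois_apply, ha]
    · exact hσ _ (L.div_mem (apply_mem_of_normal L τ hyL) hyL) hb.le
    · rw [norm_sub_rev]
      exact hτ _ (L.div_mem (apply_mem_of_normal L σ hyL) hyL) ha.le
  intro x hx hx0
  set y := (τ * σ)⁻¹ x with hy
  have hy0 : y ≠ 0 := by simpa [hy] using hx0
  have hxy : x = (τ * σ) y := by rw [hy, ← AlgEquiv.mul_apply, mul_inv_cancel, AlgEquiv.one_apply]
  have h := key y (apply_mem_of_normal L _ hx) hy0
  rw [← sub_div, norm_div, div_lt_one (norm_pos_iff.mpr hy0)] at h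
  rwa [AlgEquiv.mul_apply (σ * τ), ← hy, hxy, norm_galois_apply]

/-- A Frobenius element acts on tame inertia as the `p`-th power map. -/
theorem frobenius_conj_mem_wildInertia {φ σ : GQp p}
    (hφ : ∀ x ∈ L, ‖x‖ ≤ 1 → ‖φ x - x ^ p‖ < 1) (hσ : σ ∈ inertia L) :
    φ * σ * φ⁻¹ * (σ ^ p)⁻¹ ∈ wildInertia L := by
  have key : ∀ y ∈ L, y ≠ 0 → ‖(φ * σ * φ⁻¹) y / y - (σ ^ p) y / y‖ < 1 := by
    intro y hyL hy
    set z := φ⁻¹ y with hz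
    have hzL : z ∈ L := apply_mem_of_normal L _ hyL
    have hz0 : z ≠ 0 := by simpa [hz] using hy
    have hyz : y = φ z := by rw [hz, ← AlgEquiv.mul_apply, mul_inv_cancel, AlgEquiv.one_apply]
    have hcL : σ z / z ∈ L := L.div_mem (apply_mem_of_normal L σ hzL) hzL
    have hc := norm_apply_div_self σ hz0
    have ha := norm_apply_div_self σ hy
    have huL : z / y ∈ L := L.div_mem hzL hyL
    have hu : ‖z / y‖ = 1 := by rw [hz]; exact norm_apply_div_self _ hy
    have hu0 : z / y ≠ 0 := div_ne_zero hz0 hy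
    -- The residue of `σ y / y` depends only on `‖y‖`: `z / y` is a unit, and `σ` fixes its residue.
    have hca : ‖σ z / z - σ y / y‖ < 1 := by
      have e : σ z / z - σ y / y = (σ (z / y) - z / y) / (z / y) * (σ y / y) := by
        have : σ y ≠ 0 := by simpa using hy
        rw [map_div₀]; field_simp
      rw [e, norm_mul, ha, mul_one, norm_div, hu, div_one]
      exact hσ _ huL hu.le
    have e : (φ * σ * φ⁻¹) y / y = φ (σ z / z) := by
      rw [map_div₀, ← hyz]; rfl
    rw [e]
    refine norm_sub_lt_of_lt (hφ _ hcL hc.le) (norm_sub_lt_of_lt (y := (σ y / y) ^ p) ?_ ?_)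
    · exact norm_pow_sub_pow_lt_one hc.le ha.le hca p
    · rw [norm_sub_rev]
      exact norm_pow_apply_div_sub_lt_one L hσ hyL hy p
  intro x hx hx0
  set y := (σ ^ p)⁻¹ x with hy
  have hy0 : y ≠ 0 := by simpa [hy] using hx0
  have hxy : x = (σ ^ p) y := by rw [hy, ← AlgEquiv.mul_apply, mul_inv_cancel, AlgEquiv.one_apply]
  have h := key y (apply_mem_of_normal L _ hx) hy0
  rw [← sub_div, norm_div, div_lt_one (norm_pos_iff.mpr hy0)] at h
  rwa [AlgEquiv.mul_apply (φ * σ * φ⁻¹), ← hy, hxy, norm_galois_apply]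

theorem norm_natCast_eq_one_of_not_dvd {r : ℕ} (hr : ¬ p ∣ r) :
    ‖(r : AlgebraicClosure ℚ_[p])‖ = 1 := by
  have h := PadicAlgCl.norm_extends p (r : ℚ_[p])
  rw [map_natCast] at h
  rw [h, Padic.norm_natCast_eq_one_iff]
  exact (Nat.Prime.coprime_iff_not_dvd Fact.out).mpr hr

/-- Wild inertia is a `p`-group. -/
theorem exists_pow_mem_fixingSubgroup_of_mem_wildInertia [FiniteDimensional ℚ_[p] L] {σ : GQp p}
    (hσ : σ ∈ wildInertia L) : ∃ m : ℕ, σ ^ p ^ m ∈ L.fixingSubgroup := by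
  let f := AlgEquiv.restrictNormalHom (F := ℚ_[p]) (K₁ := AlgebraicClosure ℚ_[p]) L
  have hpow := pow_orderOf_eq_one (f σ)
  obtain ⟨m, r, hr, hN⟩ := Nat.exists_eq_pow_mul_and_not_dvd (orderOf_pos (f σ)).ne' p
    (Fact.out : p.Prime).ne_one
  refine ⟨m, ?_⟩
  -- On `L`, `τ` has order prime to `p`. If it moved `x` by `z ≠ 0`, then `τ ^ r x - x` would be `r
  -- * z` up to an error smaller than `z`, which is impossible as it vanishes and `r` is a unit.
  set τ := σ ^ p ^ m with hτ
  have hτP : τ ∈ wildInertia L := pow_mem hσ _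
  have hτr : ∀ x ∈ L, (τ ^ r) x = x := by
    intro x hx
    have h1 : f (τ ^ r) = 1 := by rw [hτ, ← pow_mul, ← hN, map_pow, hpow]
    have h2 := AlgEquiv.restrictNormal_commutes (τ ^ r) L ⟨x, hx⟩
    change algebraMap L _ (f (τ ^ r) ⟨x, hx⟩) = _ at h2
    rw [h1] at h2
    exact h2.symm
  rw [IntermediateField.mem_fixingSubgroup_iff]
  intro x hx
  by_contra hne
  set z := τ x - x with hz
  have hz0 : z ≠ 0 := sub_ne_zero.mpr hne
  have hzL : z ∈ L := L.sub_mem (apply_mem_of_normal L τ hx) hx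
  have htel : ∀ s : ℕ, ‖(τ ^ s) x - x - s * z‖ < ‖z‖ := by
    intro s
    induction s with
    | zero => simpa using hz0
    | succ s ih =>
      have e : (τ ^ (s + 1)) x - x - ((s + 1 : ℕ) : AlgebraicClosure ℚ_[p]) * z =
          ((τ ^ s) z - z) + ((τ ^ s) x - x - s * z) := by
        rw [pow_succ, AlgEquiv.mul_apply, hz, map_sub]
        push_cast
        ring
      rw [e]
      exact (IsUltrametricDist.norm_add_le_max _ _).trans_lt
        (max_lt (pow_mem hτP s z hzL hz0) ih)
  have h := htel r
  rw [hτr x hx, sub_self, zero_sub, norm_neg, norm_mul, norm_natCast_eq_one_of_not_dvd hr,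
    one_mul] at h
  exact lt_irrefl _ h

end ModPGalois

/-! ### Rings of integers and residue fields -/

namespace ModPGalois

variable {p : ℕ} [Fact p.Prime]

/-- The norm is the spectral norm, so `‖x‖ ≤ 1` says that the minimal polynomial over `ℚ_p` has
coefficients in `ℤ_p`. -/
theorem norm_le_one_iff_isIntegral (x : AlgebraicClosure ℚ_[p]) :
    ‖x‖ ≤ 1 ↔ IsIntegral ℤ_[p] x := by
  have hx : IsIntegral ℚ_[p] x := Algebra.IsIntegral.isIntegral x
  have hmon := minpoly.monic hx
  have h1 : ‖x‖ ≤ 1 ↔ ∀ n : ℕ, ‖(minpoly ℚ_[p] x).coeff n‖ ≤ 1 := by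
    rw [← spectralValue_le_one_iff hmon]
    rfl
  rw [h1]
  constructor
  · intro h
    obtain ⟨q, hq, -, hqm⟩ := Polynomial.lifts_and_degree_eq_and_monic
      (f := algebraMap ℤ_[p] ℚ_[p]) (p := minpoly ℚ_[p] x)
      ((Polynomial.lifts_iff_coeff_lifts _).mpr fun n => ⟨⟨_, h n⟩, rfl⟩) hmon
    refine ⟨q, hqm, ?_⟩
    have := minpoly.aeval ℚ_[p] x
    rw [← hq, Polynomial.aeval_map_algebraMap] at this
    exact this
  · intro h n
    rw [minpoly.isIntegrallyClosed_eq_field_fractions' ℚ_[p] h, Polynomial.coeff_map]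
    exact ((minpoly ℤ_[p] x).coeff n).2

variable (F : IntermediateField ℚ_[p] (AlgebraicClosure ℚ_[p]))

instance isScalarTower_padicInt : IsScalarTower ℤ_[p] F (AlgebraicClosure ℚ_[p]) :=
  IsScalarTower.of_algebraMap_eq fun _ => rfl

theorem isIntegral_iff_norm_le_one (x : F) :
    IsIntegral ℤ_[p] x ↔ ‖(x : AlgebraicClosure ℚ_[p])‖ ≤ 1 := by
  rw [norm_le_one_iff_isIntegral]
  exact (isIntegral_algebraMap_iff (A := F) (B := AlgebraicClosure ℚ_[p])
    (algebraMap F (AlgebraicClosure ℚ_[p])).injective).symm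

/-- The ring of integers of `F`. -/
noncomputable abbrev ringOfIntegers := integralClosure ℤ_[p] F

theorem ringOfIntegers_norm_le_one (x : ringOfIntegers F) :
    ‖((x : F) : AlgebraicClosure ℚ_[p])‖ ≤ 1 :=
  (isIntegral_iff_norm_le_one F x).mp x.2

theorem ringOfIntegers_isUnit_iff (x : ringOfIntegers F) :
    IsUnit x ↔ ‖((x : F) : AlgebraicClosure ℚ_[p])‖ = 1 := by
  constructor
  · intro hx
    obtain ⟨y, hxy⟩ := hx.exists_right_inv
    refine le_antisymm (ringOfIntegers_norm_le_one F _) ?_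
    have h2 : (x : F) * (y : F) = 1 := congrArg Subtype.val hxy
    have h3 : ((x : F) : AlgebraicClosure ℚ_[p]) * ((y : F) : AlgebraicClosure ℚ_[p]) = 1 :=
      congrArg Subtype.val h2
    have h4 := congrArg norm h3
    rw [norm_mul, norm_one] at h4
    rw [← h4]
    exact mul_le_of_le_one_right (norm_nonneg _) (ringOfIntegers_norm_le_one F y)
  · intro h
    have hx : (x : F) ≠ 0 := by
      intro h0
      rw [h0] at h
      simp at h
    have hi : IsIntegral ℤ_[p] (x : F)⁻¹ := by
      rw [isIntegral_iff_norm_le_one, IntermediateField.coe_inv, norm_inv, h, inv_one]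
    exact IsUnit.of_mul_eq_one ⟨(x : F)⁻¹, hi⟩ (Subtype.ext (mul_inv_cancel₀ hx))

theorem norm_algebraMap_padicInt (a : ℤ_[p]) :
    ‖((algebraMap ℤ_[p] (ringOfIntegers F) a : F) : AlgebraicClosure ℚ_[p])‖ = ‖a‖ :=
  PadicAlgCl.norm_extends p (a : ℚ_[p])

instance ringOfIntegers_isLocalRing : IsLocalRing (ringOfIntegers F) := by
  refine IsLocalRing.of_nonunits_add fun a b ha hb => ?_
  rw [mem_nonunits_iff, ringOfIntegers_isUnit_iff] at ha hb ⊢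
  have ha' := lt_of_le_of_ne (ringOfIntegers_norm_le_one F a) ha
  have hb' := lt_of_le_of_ne (ringOfIntegers_norm_le_one F b) hb
  have : ‖(((a + b : ringOfIntegers F) : F) : AlgebraicClosure ℚ_[p])‖ < 1 :=
    (IsUltrametricDist.norm_add_le_max _ _).trans_lt (max_lt ha' hb')
  exact this.ne

theorem mem_maximalIdeal_iff_norm_lt_one (x : ringOfIntegers F) :
    x ∈ IsLocalRing.maximalIdeal (ringOfIntegers F) ↔
      ‖((x : F) : AlgebraicClosure ℚ_[p])‖ < 1 := by
  rw [IsLocalRing.mem_maximalIdeal, mem_nonunits_iff, ringOfIntegers_isUnit_iff]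
  exact ⟨fun h => lt_of_le_of_ne (ringOfIntegers_norm_le_one F x) h, fun h => h.ne⟩

instance ringOfIntegers_isLocalHom : IsLocalHom (algebraMap ℤ_[p] (ringOfIntegers F)) where
  map_nonunit a ha := by
    rw [ringOfIntegers_isUnit_iff, norm_algebraMap_padicInt] at ha
    exact PadicInt.isUnit_iff.mpr ha

/-- The residue field of `F`. -/
noncomputable abbrev residueField := IsLocalRing.ResidueField (ringOfIntegers F)

theorem residue_eq_residue_iff (x y : ringOfIntegers F) :
    IsLocalRing.residue (ringOfIntegers F) x = IsLocalRing.residue (ringOfIntegers F) y ↔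
      ‖((x : F) : AlgebraicClosure ℚ_[p]) - ((y : F) : AlgebraicClosure ℚ_[p])‖ < 1 := by
  rw [← sub_eq_zero, ← map_sub, IsLocalRing.residue_eq_zero_iff, mem_maximalIdeal_iff_norm_lt_one]
  rfl

theorem residueField_natCast_eq_zero : (p : residueField F) = 0 := by
  rw [← map_natCast (IsLocalRing.residue (ringOfIntegers F)) p, IsLocalRing.residue_eq_zero_iff,
    mem_maximalIdeal_iff_norm_lt_one]
  have := norm_algebraMap_padicInt F (p : ℤ_[p])
  rw [map_natCast] at this
  rw [this]
  exact PadicInt.norm_natCast_lt_one_iff.mpr dvd_rfl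

instance residueField_charP : CharP (residueField F) p := by
  obtain ⟨q, hq⟩ := CharP.exists (residueField F)
  have hdvd : q ∣ p := (CharP.cast_eq_zero_iff (residueField F) q p).mp
    (residueField_natCast_eq_zero F)
  rcases (Nat.dvd_prime (Fact.out : p.Prime)).mp hdvd with h | h
  · subst h
    exact absurd rfl (CharP.char_ne_one (residueField F) 1)
  · exact h ▸ hq

section Finite

variable [FiniteDimensional ℚ_[p] F]

instance isTorsionFree_padicInt : Module.IsTorsionFree ℤ_[p] F :=
  Module.isTorsionFree_iff_algebraMap_injective.mpr
    ((algebraMap ℚ_[p] F).injective.comp (IsFractionRing.injective ℤ_[p] ℚ_[p]))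

instance ringOfIntegers_finite : Module.Finite ℤ_[p] (ringOfIntegers F) :=
  IsIntegralClosure.finite ℤ_[p] ℚ_[p] F (ringOfIntegers F)

instance ringOfIntegers_free : Module.Free ℤ_[p] (ringOfIntegers F) :=
  IsIntegralClosure.module_free ℤ_[p] ℚ_[p] F (ringOfIntegers F)

theorem finrank_ringOfIntegers :
    Module.finrank ℤ_[p] (ringOfIntegers F) = Module.finrank ℚ_[p] F :=
  IsIntegralClosure.rank ℤ_[p] ℚ_[p] F (ringOfIntegers F)

instance residueField_finite : Finite (residueField F) := by
  have : Finite (IsLocalRing.ResidueField ℤ_[p]) :=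
    Finite.of_equiv _ PadicInt.residueField.symm.toEquiv
  have : Module.Finite ℤ_[p] (residueField F) :=
    Module.Finite.of_surjective
      (IsScalarTower.toAlgHom ℤ_[p] (ringOfIntegers F) (residueField F)).toLinearMap
      IsLocalRing.residue_surjective
  have : Module.Finite (IsLocalRing.ResidueField ℤ_[p]) (residueField F) :=
    Module.Finite.of_restrictScalars_finite ℤ_[p] _ _
  exact Module.finite_of_finite (IsLocalRing.ResidueField ℤ_[p])

end Finite

/-! ### Galois action on the residue field -/

section Galois

variable (L : IntermediateField ℚ_[p] (AlgebraicClosure ℚ_[p])) [Normal ℚ_[p] L]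
  [FiniteDimensional ℚ_[p] L]

theorem exists_frobenius : ∃ φ : GQp p, ∀ x ∈ L, ‖x‖ ≤ 1 → ‖φ x - x ^ p‖ < 1 := by
  have : IsGalois ℚ_[p] L := IsGalois.mk
  have : IsFractionRing (ringOfIntegers L) L :=
    integralClosure.isFractionRing_of_finite_extension ℚ_[p] L
  have hinv : Algebra.IsInvariant ℤ_[p] (ringOfIntegers L) (L ≃ₐ[ℚ_[p]] L) := by
    refine ⟨fun b hb => (Algebra.isInvariant_of_isGalois ℤ_[p] ℚ_[p] L
      (ringOfIntegers L)).isInvariant b fun g => Subtype.ext ?_⟩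
    exact (algebraMap_galRestrict_apply ℤ_[p] g b).trans (congrArg Subtype.val (hb g))
  have : Finite (ringOfIntegers L ⧸ IsLocalRing.maximalIdeal (ringOfIntegers L)) :=
    residueField_finite L
  obtain ⟨σ, hσ⟩ := IsArithFrobAt.exists_of_isInvariant ℤ_[p] (L ≃ₐ[ℚ_[p]] L)
    (IsLocalRing.maximalIdeal (ringOfIntegers L))
  have hcard : Nat.card (ℤ_[p] ⧸ (IsLocalRing.maximalIdeal (ringOfIntegers L)).under ℤ_[p]) = p := by
    have h : (IsLocalRing.maximalIdeal (ringOfIntegers L)).under ℤ_[p] =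
        IsLocalRing.maximalIdeal ℤ_[p] := IsLocalRing.maximalIdeal_comap _
    rw [h]
    exact (Nat.card_congr PadicInt.residueField.toEquiv).trans (Nat.card_zmod p)
  obtain ⟨φ, hφ⟩ := AlgEquiv.restrictNormalHom_surjective (F := ℚ_[p]) (K₁ := L)
    (AlgebraicClosure ℚ_[p]) σ
  refine ⟨φ, fun x hx hx1 => ?_⟩
  let y : ringOfIntegers L := ⟨⟨x, hx⟩, (isIntegral_iff_norm_le_one L _).mpr hx1⟩
  have h1 := hσ y
  rw [hcard, mem_maximalIdeal_iff_norm_lt_one] at h1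
  have h2 := AlgEquiv.restrictNormal_commutes φ L ⟨x, hx⟩
  have h3 : φ.restrictNormal L = σ := hφ
  rw [h3] at h2
  rw [show φ x = _ from h2.symm]
  exact h1

/-- `g` induces an `𝔽_p`-automorphism of the finite residue field, hence a power of Frobenius. -/
theorem exists_pow_of_galois (g : GQp p) :
    ∃ j : ℕ, ∀ x ∈ L, ‖x‖ ≤ 1 → ‖g x - x ^ p ^ j‖ < 1 := by
  let σ : L ≃ₐ[ℚ_[p]] L := g.restrictNormal L
  let f : residueField L ≃+* residueField L :=
    IsLocalRing.ResidueField.mapEquiv (MulSemiringAction.toRingEquiv _ (ringOfIntegers L) σ)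
  let := ZMod.algebra (residueField L) p
  let f' : residueField L ≃ₐ[ZMod p] residueField L :=
    AlgEquiv.ofRingEquiv (f := f) fun r => by
      obtain ⟨n, rfl⟩ := ZMod.natCast_zmod_surjective r
      simp
  obtain ⟨j, hj⟩ := (FiniteField.bijective_frobeniusAlgEquivOfAlgebraic_pow (ZMod p)
    (residueField L)).2 f'
  refine ⟨j, fun x hx hx1 => ?_⟩
  let y : ringOfIntegers L := ⟨⟨x, hx⟩, (isIntegral_iff_norm_le_one L _).mpr hx1⟩
  have h1 := DFunLike.congr_fun hj (IsLocalRing.residue _ y)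
  simp only [AlgEquiv.coe_pow, FiniteField.coe_frobeniusAlgEquivOfAlgebraic_iterate, ZMod.card]
    at h1
  have h2 : f' (IsLocalRing.residue _ y) = IsLocalRing.residue _ (σ • y) := rfl
  rw [h2, ← map_pow, eq_comm, residue_eq_residue_iff] at h1
  have h3 := AlgEquiv.restrictNormal_commutes g L ⟨x, hx⟩
  rw [show g x = _ from h3.symm]
  exact h1

end Galois

end ModPGalois

/-! ### Unramified extensions: numerical criterion and existence -/

namespace ModPGalois

variable {p : ℕ} [Fact p.Prime] (F : IntermediateField ℚ_[p] (AlgebraicClosure ℚ_[p]))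
  [FiniteDimensional ℚ_[p] F]

theorem natCard_quotient_map_maximalIdeal :
    Nat.card (ringOfIntegers F ⧸ (IsLocalRing.maximalIdeal ℤ_[p]).map
      (algebraMap ℤ_[p] (ringOfIntegers F))) = p ^ Module.finrank ℚ_[p] F := by
  let b := IsLocalRing.basisQuotient (Module.Free.chooseBasis ℤ_[p] (ringOfIntegers F))
  have hc : Nat.card (ℤ_[p] ⧸ IsLocalRing.maximalIdeal ℤ_[p]) = p :=
    (Nat.card_congr PadicInt.residueField.toEquiv).trans (Nat.card_zmod p)
  rw [Nat.card_congr b.equivFun.toEquiv, Nat.card_fun, hc, Nat.card_eq_fintype_card,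
    ← finrank_ringOfIntegers, Module.finrank_eq_card_chooseBasisIndex]

theorem natCard_residueField_le : Nat.card (residueField F) ≤ p ^ Module.finrank ℚ_[p] F := by
  have hle := ((IsLocalRing.local_hom_TFAE (algebraMap ℤ_[p] (ringOfIntegers F))).out 0 2 rfl
    rfl).mp (ringOfIntegers_isLocalHom F)
  have hcard := natCard_quotient_map_maximalIdeal F
  rw [← hcard]
  have := Nat.finite_of_card_ne_zero
    (hcard.trans_ne (pow_ne_zero _ (Fact.out : p.Prime).ne_zero))
  exact Nat.card_le_card_of_surjective _ (Ideal.Quotient.factor_surjective hle)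

/-- Unramified means that the maximal ideal of `ℤ_p` generates that of the ring of integers, i.e.
that the surjection from the quotient with `p ^ [F : ℚ_p]` elements to the residue field is
bijective. -/
theorem formallyUnramified_iff_natCard_residueField :
    Algebra.FormallyUnramified ℤ_[p] (ringOfIntegers F) ↔
      Nat.card (residueField F) = p ^ Module.finrank ℚ_[p] F := by
  have hcard := natCard_quotient_map_maximalIdeal F
  constructor
  · intro h
    rw [Algebra.FormallyUnramified.map_maximalIdeal] at hcard
    exact hcard
  · intro h
    have hle := ((IsLocalRing.local_hom_TFAE (algebraMap ℤ_[p] (ringOfIntegers F))).out 0 2 rfl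
      rfl).mp (ringOfIntegers_isLocalHom F)
    have := Nat.finite_of_card_ne_zero
      (hcard.trans_ne (pow_ne_zero _ (Fact.out : p.Prime).ne_zero))
    have hbij := (Nat.bijective_iff_surjective_and_card _).mpr
      ⟨Ideal.Quotient.factor_surjective hle, hcard.trans h.symm⟩
    have hfin : Finite (IsLocalRing.ResidueField ℤ_[p]) :=
      Finite.of_equiv _ PadicInt.residueField.symm.toEquiv
    refine Algebra.FormallyUnramified.of_map_maximalIdeal (le_antisymm hle fun x hx => ?_)
    rw [← Ideal.Quotient.eq_zero_iff_mem]
    apply hbij.1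
    rw [map_zero, Ideal.Quotient.factor_mk, Ideal.Quotient.eq_zero_iff_mem]
    exact hx

variable {F}

/-- If `x ^ (p ^ j)` and `x` agree in the residue field for all integers `x` of an unramified
extension of degree `n`, then `n ∣ j`. -/
theorem dvd_of_forall_norm_sub_pow_lt_one {n : ℕ} (hF : IsUnramifiedOfDegree p n F) {j : ℕ}
    (h : ∀ x ∈ F, ‖x‖ ≤ 1 → ‖x - x ^ p ^ j‖ < 1) : n ∣ j := by
  have hcard := (formallyUnramified_iff_natCard_residueField F).mp hF.2
  rw [hF.1] at hcard
  let := ZMod.algebra (residueField F) p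
  have hfr : Module.finrank (ZMod p) (residueField F) = n := by
    rw [Module.natCard_eq_pow_finrank (K := ZMod p), Nat.card_zmod] at hcard
    exact Nat.pow_right_injective (Fact.out : p.Prime).two_le hcard
  rw [← hfr, ← FiniteField.orderOf_frobeniusAlgEquivOfAlgebraic, orderOf_dvd_iff_pow_eq_one]
  ext x
  obtain ⟨y, rfl⟩ := IsLocalRing.residue_surjective x
  simp only [AlgEquiv.coe_pow, FiniteField.coe_frobeniusAlgEquivOfAlgebraic_iterate, ZMod.card,
    AlgEquiv.one_apply]
  rw [← map_pow, eq_comm, residue_eq_residue_iff]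
  exact h _ (y : F).2 (ringOfIntegers_norm_le_one F y)

variable (p) in
-- Lift the minimal polynomial of a generator of the field with `p ^ n` elements to `ℤ_p` and adjoin
-- a root. The residue degree is at least `n` and at most `[F : ℚ_p]`, which is at most `n`, so all
-- are equal.
theorem exists_isUnramifiedOfDegree {n : ℕ} (hn : n ≠ 0) :
    ∃ F : IntermediateField ℚ_[p] (AlgebraicClosure ℚ_[p]), IsUnramifiedOfDegree p n F := by
  obtain ⟨θ, hθ⟩ := Field.exists_primitive_element (ZMod p) (GaloisField p n)
  have hθi : IsIntegral (ZMod p) θ := Algebra.IsIntegral.isIntegral θ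
  have hdeg : (minpoly (ZMod p) θ).natDegree = n := by
    exact ((Field.primitive_element_iff_minpoly_natDegree_eq (ZMod p) θ).mp hθ).trans
      (GaloisField.finrank p hn)
  obtain ⟨f, hf, hfdeg, hfm⟩ := Polynomial.lifts_and_natDegree_eq_and_monic
    (f := PadicInt.toZMod) (p := minpoly (ZMod p) θ)
    ((Polynomial.mem_lifts _).mpr
      (Polynomial.map_surjective _ (ZMod.ringHom_surjective PadicInt.toZMod) _))
    (minpoly.monic hθi)
  have hfQ : (f.map (algebraMap ℤ_[p] ℚ_[p])).Monic := hfm.map _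
  obtain ⟨α, hα⟩ := IsAlgClosed.exists_aeval_eq_zero (AlgebraicClosure ℚ_[p])
    (f.map (algebraMap ℤ_[p] ℚ_[p])) (by
      rw [hfm.degree_map, Polynomial.degree_eq_natDegree hfm.ne_zero, hfdeg, hdeg]
      exact_mod_cast hn)
  have hαi : IsIntegral ℚ_[p] α := Algebra.IsIntegral.isIntegral α
  let F := IntermediateField.adjoin ℚ_[p] {α}
  have hFfin : FiniteDimensional ℚ_[p] F := IntermediateField.adjoin.finiteDimensional hαi
  have hFle : Module.finrank ℚ_[p] F ≤ n := by
    rw [IntermediateField.adjoin.finrank hαi, ← hdeg, ← hfdeg,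
      ← hfm.natDegree_map (algebraMap ℤ_[p] ℚ_[p])]
    exact Polynomial.natDegree_le_of_dvd (minpoly.dvd _ _ hα) hfQ.ne_zero
  let a' : F := IntermediateField.AdjoinSimple.gen ℚ_[p] α
  have ha' : Polynomial.aeval a' f = 0 := by
    apply (algebraMap F (AlgebraicClosure ℚ_[p])).injective
    rw [map_zero, ← Polynomial.aeval_algebraMap_apply]
    rw [Polynomial.aeval_map_algebraMap] at hα
    exact hα
  let a : ringOfIntegers F := ⟨a', f, hfm, ha'⟩
  have ha : Polynomial.aeval a f = 0 := by
    apply Subtype.val_injective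
    change algebraMap (ringOfIntegers F) F _ = 0
    rw [← Polynomial.aeval_algebraMap_apply]
    exact ha'
  let := ZMod.algebra (residueField F) p
  let r := IsLocalRing.residue (ringOfIntegers F)
  have hcomp : r.comp (algebraMap ℤ_[p] (ringOfIntegers F)) =
      (algebraMap (ZMod p) (residueField F)).comp PadicInt.toZMod := by
    ext x
    have h1 := PadicInt.sub_zmodRepr_mem x
    have h2 : r (algebraMap ℤ_[p] (ringOfIntegers F) (x - x.zmodRepr)) = 0 := by
      rw [IsLocalRing.residue_eq_zero_iff]
      exact (map_mem_nonunits_iff (algebraMap ℤ_[p] (ringOfIntegers F)) _).mpr h1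
    rw [← PadicInt.ker_toZMod, RingHom.mem_ker] at h1
    rw [map_sub, map_sub, sub_eq_zero, map_natCast, map_natCast] at h2
    rw [map_sub, sub_eq_zero, map_natCast] at h1
    rw [RingHom.comp_apply, RingHom.comp_apply, h1, h2, map_natCast]
  have hra : Polynomial.aeval (r a) (minpoly (ZMod p) θ) = 0 := by
    rw [← hf, Polynomial.aeval_def, Polynomial.eval₂_map, ← hcomp, ← Polynomial.hom_eval₂]
    rw [Polynomial.aeval_def] at ha
    rw [ha, map_zero]
  have hmin : minpoly (ZMod p) θ = minpoly (ZMod p) (r a) :=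
    minpoly.eq_of_irreducible_of_monic (minpoly.irreducible hθi) hra (minpoly.monic hθi)
  have hle1 : n ≤ Module.finrank (ZMod p) (residueField F) := by
    rw [← hdeg, hmin]
    exact minpoly.natDegree_le _
  have hle2 := natCard_residueField_le F
  have hcard : Nat.card (residueField F) = p ^ Module.finrank (ZMod p) (residueField F) := by
    rw [Module.natCard_eq_pow_finrank (K := ZMod p), Nat.card_zmod]
  rw [hcard, Nat.pow_le_pow_iff_right (Fact.out : p.Prime).one_lt] at hle2
  refine ⟨F, by omega, ?_⟩
  rw [formallyUnramified_iff_natCard_residueField, hcard]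
  congr 1
  omega

end ModPGalois

/-! ### Frobenius exponents, uniqueness of `F`, and the stable line -/

namespace ModPGalois

variable {p : ℕ} [Fact p.Prime]

/-- `g` acts on the residue field of `L` as the `j`-th power of the Frobenius. -/
def IsFrobPow (L : IntermediateField ℚ_[p] (AlgebraicClosure ℚ_[p])) (g : GQp p) (j : ℕ) : Prop :=
  ∀ x ∈ L, ‖x‖ ≤ 1 → ‖g x - x ^ p ^ j‖ < 1

namespace IsFrobPow

variable {L : IntermediateField ℚ_[p] (AlgebraicClosure ℚ_[p])} {g h φ : GQp p} {i j : ℕ}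

theorem mul (hg : IsFrobPow L g j) (hh : IsFrobPow L h i) : IsFrobPow L (g * h) (i + j) := by
  intro x hx hx1
  refine norm_sub_lt_of_lt (y := g (x ^ p ^ i)) ?_ ?_
  · rw [AlgEquiv.mul_apply, ← map_sub, norm_galois_apply]
    exact hh x hx hx1
  · rw [pow_add, pow_mul]
    exact hg _ (pow_mem hx _) (by rw [norm_pow]; exact pow_le_one₀ (norm_nonneg _) hx1)

theorem pow (hφ : IsFrobPow L φ 1) (j : ℕ) : IsFrobPow L (φ ^ j) j := by
  induction j with
  | zero => intro x _ _; simp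
  | succ j ih => rw [pow_succ']; exact hφ.mul ih

theorem inv_mul_mem_inertia [Normal ℚ_[p] L] (hg : IsFrobPow L g j) (hh : IsFrobPow L h j) :
    h⁻¹ * g ∈ inertia L := by
  intro x hx hx1
  have e : (h⁻¹ * g) x - x = h⁻¹ (g x - h x) := by
    rw [map_sub, ← AlgEquiv.mul_apply, ← AlgEquiv.mul_apply, inv_mul_cancel, AlgEquiv.one_apply]
  rw [e, norm_galois_apply]
  refine norm_sub_lt_of_lt (hg x hx hx1) ?_
  rw [norm_sub_rev]
  exact hh x hx hx1

theorem dvd_of_mem_fixingSubgroup {n : ℕ}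
    {F : IntermediateField ℚ_[p] (AlgebraicClosure ℚ_[p])} [FiniteDimensional ℚ_[p] F]
    (hF : IsUnramifiedOfDegree p n F) (hFL : F ≤ L) (hgL : IsFrobPow L g j)
    (hg : g ∈ F.fixingSubgroup) : n ∣ j := by
  refine dvd_of_forall_norm_sub_pow_lt_one hF fun x hx hx1 => ?_
  have := hgL x (hFL hx) hx1
  rwa [(IntermediateField.mem_fixingSubgroup_iff _ _).mp hg x hx] at this

end IsFrobPow

theorem IsUnramifiedOfDegree.finiteDimensional {n : ℕ} (hn : n ≠ 0)
    {F : IntermediateField ℚ_[p] (AlgebraicClosure ℚ_[p])} (hF : IsUnramifiedOfDegree p n F) :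
    FiniteDimensional ℚ_[p] F :=
  FiniteDimensional.of_finrank_pos (by rw [hF.1]; exact Nat.pos_of_ne_zero hn)

theorem IsUnramifiedOfDegree.index_fixingSubgroup {n : ℕ}
    {F : IntermediateField ℚ_[p] (AlgebraicClosure ℚ_[p])} (hF : IsUnramifiedOfDegree p n F) :
    F.fixingSubgroup.index = n := by
  have : IsGalois ℚ_[p] (AlgebraicClosure ℚ_[p]) := IsGalois.mk
  rw [← IntermediateField.finrank_eq_fixingSubgroup_index, hF.1]

/-- The Galois group of the unramified extension of degree `n` consists of the elements acting on
residue fields as powers of the `n`-th power of the Frobenius. -/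
theorem IsUnramifiedOfDegree.mem_fixingSubgroup_iff {n : ℕ} (hn : n ≠ 0)
    {F : IntermediateField ℚ_[p] (AlgebraicClosure ℚ_[p])} (hF : IsUnramifiedOfDegree p n F)
    (L : IntermediateField ℚ_[p] (AlgebraicClosure ℚ_[p])) [Normal ℚ_[p] L]
    [FiniteDimensional ℚ_[p] L] (hFL : F ≤ L) (g : GQp p) :
    g ∈ F.fixingSubgroup ↔ ∃ j, n ∣ j ∧ IsFrobPow L g j := by
  have := hF.finiteDimensional hn
  constructor
  · intro hg
    obtain ⟨j, hj⟩ := exists_pow_of_galois L g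
    exact ⟨j, IsFrobPow.dvd_of_mem_fixingSubgroup hF hFL hj hg, hj⟩
  · rintro ⟨j, hnj, hj⟩
    obtain ⟨φ, hφ⟩ := exists_frobenius L
    have hφ1 : IsFrobPow L φ 1 := by simpa [IsFrobPow] using hφ
    -- These `n` cosets are distinct, hence exhaust the quotient. So `g * φ ^ i` fixes `F` for some
    -- `i < n`; then `n ∣ i + j`, which forces `i = 0`.
    let f : Fin n → GQp p ⧸ F.fixingSubgroup := fun i => ((φ ^ (i : ℕ) : GQp p) : GQp p ⧸ _)
    have hlt : ∀ a b : ℕ, a ≤ b → b < n →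
        ((φ ^ a : GQp p) : GQp p ⧸ F.fixingSubgroup) = ((φ ^ b : GQp p) : GQp p ⧸ _) → a = b := by
      intro a b hab hb h
      rw [QuotientGroup.eq] at h
      have e : (φ ^ a)⁻¹ * φ ^ b = φ ^ (b - a) := by
        rw [inv_mul_eq_iff_eq_mul, ← pow_add]
        congr 1
        omega
      rw [e] at h
      have hd := IsFrobPow.dvd_of_mem_fixingSubgroup hF hFL (hφ1.pow _) h
      have := Nat.eq_zero_of_dvd_of_lt hd (by omega)
      omega
    have hinj : Function.Injective f := by
      intro a b h
      rcases le_total (a : ℕ) b with hab | hab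
      · exact Fin.ext (hlt a b hab b.2 h)
      · exact Fin.ext (hlt b a hab a.2 h.symm).symm
    have hcard : Nat.card (GQp p ⧸ F.fixingSubgroup) = n := hF.index_fixingSubgroup
    have : Finite (GQp p ⧸ F.fixingSubgroup) := Nat.finite_of_card_ne_zero (hcard.trans_ne hn)
    have hbij := (Nat.bijective_iff_injective_and_card f).mpr
      ⟨hinj, (Nat.card_fin n).trans hcard.symm⟩
    obtain ⟨i, hi⟩ := hbij.2 ((g⁻¹ : GQp p) : GQp p ⧸ F.fixingSubgroup)
    have hi' := QuotientGroup.eq.mp hi.symm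
    rw [inv_inv] at hi'
    have hd := IsFrobPow.dvd_of_mem_fixingSubgroup hF hFL (hj.mul (hφ1.pow i)) hi'
    have hi0 := Nat.eq_zero_of_dvd_of_lt ((Nat.dvd_add_iff_left hnj).mpr hd) i.2
    rwa [hi0, pow_zero, mul_one] at hi'

variable (p) in
theorem existsUnique_isUnramifiedOfDegree {n : ℕ} (hn : n ≠ 0) :
    ∃! F : IntermediateField ℚ_[p] (AlgebraicClosure ℚ_[p]), IsUnramifiedOfDegree p n F := by
  have hGal : IsGalois ℚ_[p] (AlgebraicClosure ℚ_[p]) := IsGalois.mk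
  obtain ⟨F, hF⟩ := exists_isUnramifiedOfDegree p hn
  refine ⟨F, hF, fun F' hF' => ?_⟩
  have := hF.finiteDimensional hn
  have := hF'.finiteDimensional hn
  let L := IntermediateField.normalClosure ℚ_[p] (F ⊔ F' : IntermediateField _ _)
    (AlgebraicClosure ℚ_[p])
  have hL := IntermediateField.le_normalClosure (F ⊔ F')
  have h : F'.fixingSubgroup = F.fixingSubgroup := by
    ext g
    rw [hF.mem_fixingSubgroup_iff hn L (le_sup_left.trans hL),
      hF'.mem_fixingSubgroup_iff hn L (le_sup_right.trans hL)]
  rw [← InfiniteGalois.fixedField_fixingSubgroup F', h,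
    InfiniteGalois.fixedField_fixingSubgroup F]

variable {k V : Type*} [Field k] [CharP k p] [IsAlgClosed k] [AddCommGroup V] [Module k V]
  [FiniteDimensional k V]

/-- A continuous irreducible representation of dimension `n` and characteristic `p` contains a line
stable under the Galois group of the unramified extension of degree `n`. -/
theorem exists_eigenvector_fixingSubgroup {n : ℕ} (hn : Module.finrank k V = n)
    {ρ : Representation k (GQp p) V} (hcont : IsLocallyConstant (fun g : GQp p => ρ g))
    (hirr : ρ.IsIrreducible) {F : IntermediateField ℚ_[p] (AlgebraicClosure ℚ_[p])}
    (hF : IsUnramifiedOfDegree p n F) :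
    ∃ w : V, w ≠ 0 ∧ ∀ h ∈ F.fixingSubgroup, ∃ c : k, ρ h w = c • w := by
  have hGal : IsGalois ℚ_[p] (AlgebraicClosure ℚ_[p]) := IsGalois.mk
  have := Representation.nontrivial_of_isIrreducible hirr
  have hn0 : n ≠ 0 := hn ▸ Module.finrank_pos.ne'
  have := hF.finiteDimensional hn0
  obtain ⟨E, hEfin, hEnorm, hE⟩ := (krullTopology_mem_nhds_one_iff_of_normal ℚ_[p]
    (AlgebraicClosure ℚ_[p]) {g : GQp p | ρ g = 1}).mp
    ((hcont.isOpen_fiber 1).mem_nhds (map_one ρ))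
  -- `L` must contain `E`, so that `ρ` is trivial on its fixing subgroup, and `F`, so that Frobenius
  -- exponents on `L` detect `G_F`.
  let L := IntermediateField.normalClosure ℚ_[p] (E ⊔ F : IntermediateField _ _)
    (AlgebraicClosure ℚ_[p])
  have hL := IntermediateField.le_normalClosure (E ⊔ F)
  have hker : ∀ g ∈ L.fixingSubgroup, ρ g = 1 := fun g hg =>
    hE (IntermediateField.fixingSubgroup_antitone (le_sup_left.trans hL) hg)
  obtain ⟨φ, hφ⟩ := exists_frobenius L
  have hφ1 : IsFrobPow L φ 1 := by simpa [IsFrobPow] using hφ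
  have hgen : ∀ (g : GQp p) (j : ℕ), IsFrobPow L g j → ∃ σ ∈ inertia L, g = φ ^ j * σ :=
    fun g j hj => ⟨_, hj.inv_mul_mem_inertia (hφ1.pow j), (mul_inv_cancel_left _ _).symm⟩
  obtain ⟨w, hw0, hw⟩ := Representation.exists_eigenvector_of_isIrreducible p hirr
    hcont.range_finite (wildInertia L) (inertia L) (fun g hg => by
      obtain ⟨m, hm⟩ := exists_pow_mem_fixingSubgroup_of_mem_wildInertia L hg
      exact ⟨m, by rw [← map_pow, hker _ hm]⟩)
    (fun σ hσ τ hτ => commutator_mem_wildInertia L hσ hτ) φ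
    (fun σ hσ => frobenius_conj_mem_wildInertia L hφ hσ) (fun g => by
      obtain ⟨j, hj⟩ := exists_pow_of_galois L g
      exact ⟨j, hgen g j hj⟩)
  refine ⟨w, hw0, fun h hh => ?_⟩
  obtain ⟨j, hnj, hj⟩ := (hF.mem_fixingSubgroup_iff hn0 L (le_sup_right.trans hL) h).mp hh
  obtain ⟨σ, hσ, rfl⟩ := hgen h j hj
  exact hw j (hn ▸ hnj) σ hσ

end ModPGalois

/-- Coefficients `𝔽̄_p` carry the discrete topology, so that a finite-dimensional representation
or a character is continuous iff it is locally constant. -/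
theorem mainTheorem7 (p : ℕ) [Fact p.Prime] (n : ℕ)
    {V : Type*} [AddCommGroup V] [Module (AlgebraicClosure (ZMod p)) V]
    [FiniteDimensional (AlgebraicClosure (ZMod p)) V]
    (hn : Module.finrank (AlgebraicClosure (ZMod p)) V = n)
    (ρ : Representation (AlgebraicClosure (ZMod p)) (ModPGalois.GQp p) V)
    (hcont : IsLocallyConstant (fun g : ModPGalois.GQp p => ρ g))
    (hirr : ρ.IsIrreducible) :
    (∃! F : IntermediateField ℚ_[p] (AlgebraicClosure ℚ_[p]),
      ModPGalois.IsUnramifiedOfDegree p n F) ∧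
    ∀ F : IntermediateField ℚ_[p] (AlgebraicClosure ℚ_[p]),
      ModPGalois.IsUnramifiedOfDegree p n F →
      ∃ χ : F.fixingSubgroup →* (AlgebraicClosure (ZMod p))ˣ,
        IsLocallyConstant (fun g : F.fixingSubgroup => χ g) ∧
        Nonempty (ρ.Equiv (ModPGalois.indCharacter F.fixingSubgroup χ)) := by

  have := Representation.nontrivial_of_isIrreducible hirr
  have hn0 : n ≠ 0 := hn ▸ Module.finrank_pos.ne'
  refine ⟨ModPGalois.existsUnique_isUnramifiedOfDegree p hn0, fun F hF => ?_⟩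
  obtain ⟨w, hw0, hw⟩ := ModPGalois.exists_eigenvector_fixingSubgroup hn hcont hirr hF
  obtain ⟨χ, hχ⟩ := Representation.exists_character_of_forall_exists_smul ρ F.fixingSubgroup w
    hw0 hw
  refine ⟨χ, ?_, Representation.nonempty_equiv_indCharacter hirr F.fixingSubgroup
    (hF.index_fixingSubgroup.trans hn.symm) χ w hw0 hχ⟩
  -- Since `w ≠ 0`, the value `χ g` is determined by `ρ g w`, so `χ` inherits local constancy from
  -- `ρ`.
  refine (IsLocallyConstant.iff_eventually_eq _).mpr fun g => ?_
  have h := (hcont.comp_continuous continuous_subtype_val).eventually_eq g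
  filter_upwards [h] with g' hg'
  refine Units.ext (smul_left_injective _ hw0 ?_)
  change (χ g' : AlgebraicClosure (ZMod p)) • w = (χ g : AlgebraicClosure (ZMod p)) • w
  rw [← hχ, ← hχ]
  exact LinearMap.congr_fun hg' w
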